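/- Let $a,b,c$ be real numbers with $0<a<b<c$. Put $c_0:=c-\lfloor c/b\rfloor b$ and $c_1:=\lfloor c/b\rfloor b-\big\lfloor \lfloor c/b\rfloor b/a\big\rfloor a$. For $t\in\mathbb R$ let $\mathbf M_{a,b,c}(t):=\big(\chi_{[0,c)}(t-\mu+\lambda)\big)_{\mu\in a\mathbb Z,\ \lambda\in b\mathbb Z}$, an infinite matrix each of whose rows has finitely many nonzero entries. Let $\mathcal B_b^0$ be the set of all vectors $\mathbf x=(\mathbf x(\lambda))_{\lambda\in b\mathbb Z}$ with entries in $\{0,1\}$ and $\mathbf x(0)=1$. Define $$\mathcal S_{a,b,c}:=\{t\in\mathbb R:\ \mathbf M_{a,b,c}(t)\mathbf x=\mathbf 1\text{ for some }\mathbf x\in\mathcal B_b^0\},\qquad \mathcal D_{a,b,c}:=\{t\in\mathbb R:\ \mathbf M_{a,b,c}(t)\mathbf x=\mathbf 2\text{ for some }\mathbf x\in\mathcal B_b^0\},$$ where $\mathbf 1$ and $\mathbf 2$ are the vectors indexed by $a\mathbb Z$ all of whose entries are $1$, respectively $2$. Assume that $\lfloor c/b\rfloor\ge 2$, $b-a<c_0<a$,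 $0<c_1<2a-b$ and $\mathcal S_{a,b,c}\neq\emptyset$, and that either $a/b\notin\mathbb Q$, or $a/b=p/q$ and $c/b\in\mathbb Z/q$ for some coprime positive integers $p$ and $q$. Then $\mathcal D_{a,b,c}=\emptyset$ if and only if $$(\lfloor c/b\rfloor+1)\,\big|\mathcal S_{a,b,c}\cap[0,c_0+a-b)\big|+\lfloor c/b\rfloor\,\big|\mathcal S_{a,b,c}\cap[c_0,a)\big|=a,$$ where $|E|$ denotes the Lebesgue measure of $E$. -/

import Mathlib

open MeasureTheory

noncomputable section

namespace ABCProblem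

/-- The infinite matrix `M_{a,b,c}(t) = (χ_{[0,c)}(t - μ + λ))` with `μ ∈ aℤ`, `λ ∈ bℤ`.
For `a, b > 0` the row index `μ = m a` and the column index `λ = n b` are recorded by the
integers `m` and `n`. -/
def infMatrix (a b c t : ℝ) : Matrix ℤ ℤ ℝ :=
  fun m n => Set.indicator (Set.Ico 0 c) (fun _ => (1 : ℝ)) (t - m * a + n * b)

/-- The matrix-vector product `M_{a,b,c}(t) x` (each row has only finitely many nonzero entries
when `b > 0`). -/
def infMulVec (a b c t : ℝ) (x : ℤ → ℝ) : ℤ → ℝ :=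
  fun m => ∑' n : ℤ, infMatrix a b c t m n * x n

/-- Binary vectors indexed by `bℤ ≃ ℤ` that take the value one at the origin. -/
def binaryVectors : Set (ℤ → ℝ) :=
  {x | (∀ n, x n = 0 ∨ x n = 1) ∧ x 0 = 1}

/-- All `t` for which `M_{a,b,c}(t) x = 1` (the constant vector) has a binary solution `x`
with `x 0 = 1`. -/
def setS (a b c : ℝ) : Set ℝ :=
  {t | ∃ x ∈ binaryVectors, infMulVec a b c t x = fun _ => 1}

/-- All `t` for which `M_{a,b,c}(t) x = 2` (the constant vector) has a binary solution `x`
with `x 0 = 1`. -/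
def setD (a b c : ℝ) : Set ℝ :=
  {t | ∃ x ∈ binaryVectors, infMulVec a b c t x = fun _ => 2}

/-- `c₀ = c - ⌊c/b⌋ b`. -/
def cZero (b c : ℝ) : ℝ := c - ⌊c / b⌋ * b

/-- `c₁ = ⌊c/b⌋ b - ⌊⌊c/b⌋ b / a⌋ a`. -/
def cOne (a b c : ℝ) : ℝ := ⌊c / b⌋ * b - ⌊(⌊c / b⌋ * b) / a⌋ * a

end ABCProblem

end

namespace ABCProblem

open Filter Topology

/-! A binary solution of `M(t) x = k` is a set `X` of integers such that each interval `[m a, m a +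
c)` contains exactly `k` of the points `t + n b`, `n ∈ X`: a `k`-fold cover. `setS` and `setD` are
the `t` for which some one-fold, respectively two-fold, cover contains `0`.

Existence of a `k`-fold cover does not depend on `t`: it is invariant under `aℤ + bℤ` and stable
under limits from the right, so it holds for all `t` or for none (`coverSet_eq_univ`). Taking every
second point of a two-fold cover shows `setD ⊆ setS` (`coverSet_two_subset`), and two distinct
one-fold covers are disjoint, with a two-fold cover as union (`IsCover.union`).

For each `s`, `multiplicity` counts the points `s - j b` of `setS`, `0 ≤ j ≤ ⌊c/b⌋`, whose interval
reaches beyond `s`. Its integral over a period is the left side of the criterion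
(`integral_multiplicity_eq`). It is at least `k` everywhere for `k = 1, 2` as soon as `k`-fold
covers containing `0` exist (`le_multiplicity`), and at most `1` when `setD` is empty
(`multiplicity_le_one`). The integral is thus `a` if `setD = ∅` and at least `2a` otherwise. -/

/-- The column indices `n` with `t - m a + n b ∈ [0, c)`. -/
noncomputable def window (a b c t : ℝ) (m : ℤ) : Finset ℤ :=
  Finset.Ico ⌈(m * a - t) / b⌉ ⌈(m * a + c - t) / b⌉

theorem mem_window {a b c t : ℝ} (hb : 0 < b) {m n : ℤ} :
    n ∈ window a b c t m ↔ m * a ≤ t + n * b ∧ t + n * b < m * a + c := by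
  rw [window, Finset.mem_Ico, Int.ceil_le, Int.lt_ceil, div_le_iff₀ hb, lt_div_iff₀ hb]
  constructor <;> rintro ⟨h₁, h₂⟩ <;> constructor <;> linarith

open Classical in
/-- Every window contains exactly `k` points of `X`. -/
def IsCover (a b c : ℝ) (k : ℕ) (t : ℝ) (X : Set ℤ) : Prop :=
  ∀ m, ((window a b c t m).filter (· ∈ X)).card = k

/-- The translates `t` for which some `k`-fold cover contains `Z`. -/
def coverSet (a b c : ℝ) (k : ℕ) (Z : Set ℤ) : Set ℝ :=
  {t | ∃ X, Z ⊆ X ∧ IsCover a b c k t X}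

open Classical in
theorem infMulVec_indicator {a b c : ℝ} (hb : 0 < b) (t : ℝ) (X : Set ℤ) (m : ℤ) :
    infMulVec a b c t (X.indicator 1) m = ((window a b c t m).filter (· ∈ X)).card := by
  rw [infMulVec, tsum_eq_sum (s := (window a b c t m).filter (· ∈ X))]
  · rw [Finset.card_eq_sum_ones, Nat.cast_sum]
    refine Finset.sum_congr rfl fun n hn => ?_
    obtain ⟨hn, hX⟩ := Finset.mem_filter.1 hn
    rw [mem_window hb] at hn
    have : t - m * a + n * b ∈ Set.Ico 0 c := ⟨by linarith, by linarith⟩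
    simp [infMatrix, Set.indicator_of_mem this, Set.indicator_of_mem hX]
  · intro n hn
    by_cases hX : n ∈ X
    · have : t - m * a + n * b ∉ Set.Ico 0 c := fun h => hn <| Finset.mem_filter.2
        ⟨(mem_window hb).2 ⟨by linarith [h.1], by linarith [h.2]⟩, hX⟩
      simp [infMatrix, Set.indicator_of_notMem this]
    · simp [Set.indicator_of_notMem hX]

theorem exists_infMulVec_eq_iff {a b c : ℝ} (hb : 0 < b) (t : ℝ) (k : ℕ) :
    (∃ x ∈ binaryVectors, infMulVec a b c t x = fun _ => (k : ℝ)) ↔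
      t ∈ coverSet a b c k {0} := by
  classical
  constructor
  · rintro ⟨x, ⟨hx, hx0⟩, h⟩
    have hxX : x = {n | x n = 1}.indicator 1 := by
      funext n
      rcases hx n with h0 | h1
      · simp [Set.indicator, h0]
      · simp [Set.indicator, h1]
    refine ⟨{n | x n = 1}, by simpa using hx0, fun m => ?_⟩
    have := congrFun h m
    rw [hxX, infMulVec_indicator hb] at this
    exact_mod_cast this
  · rintro ⟨X, h0, hX⟩
    refine ⟨X.indicator 1, ⟨fun n => ?_, ?_⟩, funext fun m => ?_⟩
    · by_cases h : n ∈ X <;> simp [h]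
    · have : (0 : ℤ) ∈ X := h0 rfl
      simp [this]
    · rw [infMulVec_indicator hb, hX m]

theorem setS_eq {a b c : ℝ} (hb : 0 < b) : setS a b c = coverSet a b c 1 {0} := by
  ext t
  simpa [setS] using exists_infMulVec_eq_iff (a := a) (c := c) hb t 1

theorem setD_eq {a b c : ℝ} (hb : 0 < b) : setD a b c = coverSet a b c 2 {0} := by
  ext t
  simpa [setD] using exists_infMulVec_eq_iff (a := a) (c := c) hb t 2

/-! ### Translations by `aℤ` and `bℤ`. -/

theorem window_add_left {a b c : ℝ} (hb : 0 < b) (t : ℝ) (i m : ℤ) :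
    window a b c (t + i * a) m = window a b c t (m - i) := by
  ext n
  rw [mem_window hb, mem_window hb]
  push_cast
  constructor <;> rintro ⟨h₁, h₂⟩ <;> constructor <;> linarith

theorem IsCover.add_left {a b c : ℝ} (hb : 0 < b) {k : ℕ} {t : ℝ} {X : Set ℤ}
    (h : IsCover a b c k t X) (i : ℤ) : IsCover a b c k (t + i * a) X := fun m => by
  rw [window_add_left hb]
  exact h _

theorem coverSet_add_left {a b c : ℝ} (hb : 0 < b) {k : ℕ} {Z : Set ℤ} {t : ℝ} (i : ℤ) :
    t + i * a ∈ coverSet a b c k Z ↔ t ∈ coverSet a b c k Z := by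
  constructor
  · rintro ⟨X, hZ, hX⟩
    have := hX.add_left hb (-i)
    rw [show t + i * a + ((-i : ℤ) : ℝ) * a = t by push_cast; ring] at this
    exact ⟨X, hZ, this⟩
  · rintro ⟨X, hZ, hX⟩
    exact ⟨X, hZ, hX.add_left hb i⟩

theorem IsCover.add_right {a b c : ℝ} (hb : 0 < b) {k : ℕ} {t : ℝ} {X : Set ℤ}
    (h : IsCover a b c k t X) (j : ℤ) : IsCover a b c k (t + j * b) {n | n + j ∈ X} := fun m => by
  classical
  rw [← h m]
  refine Finset.card_bij' (fun n _ => n + j) (fun n _ => n - j) ?_ ?_ ?_ ?_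
  · intro n hn
    rw [Finset.mem_filter, mem_window hb] at hn ⊢
    refine ⟨?_, hn.2⟩
    push_cast
    exact ⟨by linarith [hn.1.1], by linarith [hn.1.2]⟩
  · intro n hn
    rw [Finset.mem_filter, mem_window hb] at hn ⊢
    refine ⟨?_, by simpa using hn.2⟩
    push_cast
    exact ⟨by linarith [hn.1.1], by linarith [hn.1.2]⟩
  · intro n _
    simp
  · intro n _
    simp

theorem IsCover.mem_coverSet {a b c : ℝ} (hb : 0 < b) {k : ℕ} {t : ℝ} {X : Set ℤ}
    (h : IsCover a b c k t X) {n : ℤ} (hn : n ∈ X) : t + n * b ∈ coverSet a b c k {0} :=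
  ⟨_, by simpa using hn, h.add_right hb n⟩

/-! ### Limits of covers and measurability. -/

/-- Limits of covers along a filter on which every window is eventually constant. -/
theorem mem_coverSet_of_frequently {a b c : ℝ} {k : ℕ} {Z : Set ℤ} {s : ℝ} {F : Filter ℝ}
    (hF : ∀ m, ∀ᶠ s' in F, window a b c s' m = window a b c s m)
    (h : ∃ᶠ s' in F, s' ∈ coverSet a b c k Z) : s ∈ coverSet a b c k Z := by
  classical
  have : (F ⊓ 𝓟 (coverSet a b c k Z)).NeBot := frequently_mem_iff_neBot.1 h
  -- An ultrafilter decides `n ∈ X s'` for every `n`, so a pointwise limit of the covers exists.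
  -- Each window is finite, so the limit agrees on it with some `X s'`.
  let U : Ultrafilter ℝ := Ultrafilter.of (F ⊓ 𝓟 (coverSet a b c k Z))
  have hU : (U : Filter ℝ) ≤ F ⊓ 𝓟 (coverSet a b c k Z) := Ultrafilter.of_le _
  have hUE : ∀ᶠ s' in (U : Filter ℝ), s' ∈ coverSet a b c k Z :=
    (hU.trans inf_le_right) (mem_principal_self _)
  have hX : ∀ s', ∃ X : Set ℤ, s' ∈ coverSet a b c k Z → Z ⊆ X ∧ IsCover a b c k s' X := by
    intro s'
    by_cases hs : s' ∈ coverSet a b c k Z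
    · obtain ⟨X, h⟩ := hs
      exact ⟨X, fun _ => h⟩
    · exact ⟨∅, fun h => absurd h hs⟩
  choose X hX using hX
  refine ⟨{n | ∀ᶠ s' in (U : Filter ℝ), n ∈ X s'}, fun z hz => ?_, fun m => ?_⟩
  · filter_upwards [hUE] with s' hs using (hX s' hs).1 hz
  · have h₁ : ∀ᶠ s' in (U : Filter ℝ), window a b c s' m = window a b c s m :=
      (hU.trans inf_le_left) (hF m)
    have h₂ : ∀ᶠ s' in (U : Filter ℝ), ∀ n ∈ window a b c s m,
        ((∀ᶠ s' in (U : Filter ℝ), n ∈ X s') ↔ n ∈ X s') := by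
      rw [Filter.eventually_all_finset]
      intro n _
      by_cases hn : ∀ᶠ s' in (U : Filter ℝ), n ∈ X s'
      · filter_upwards [hn] with s' hs
        exact ⟨fun _ => hs, fun _ => hn⟩
      · filter_upwards [Ultrafilter.eventually_not.2 hn] with s' hs
        exact ⟨fun h => absurd h hn, fun h => absurd h hs⟩
    obtain ⟨s', hs, h₁, h₂⟩ := (hUE.and (h₁.and h₂)).exists
    rw [← (hX s' hs).2 m, h₁]
    exact congrArg Finset.card (Finset.filter_congr h₂)

/-- `⌈·⌉` is locally constant from the left, and `s' ↦ (y - s') / b` reverses the order. -/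
theorem eventually_window_eq {a b c : ℝ} (hb : 0 < b) (s : ℝ) (m : ℤ) :
    ∀ᶠ s' in 𝓝[≥] s, window a b c s' m = window a b c s m := by
  have key : ∀ y : ℝ, ∀ᶠ s' in 𝓝[≥] s, ⌈(y - s') / b⌉ = ⌈(y - s) / b⌉ := by
    intro y
    have h₁ : Tendsto (fun s' => (y - s') / b) (𝓝[≥] s) (𝓝[≤] ((y - s) / b)) := by
      refine tendsto_nhdsWithin_iff.2 ⟨?_, ?_⟩
      · have : Continuous fun s' : ℝ => (y - s') / b := by fun_prop
        exact (this.tendsto s).mono_left nhdsWithin_le_nhds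
      · filter_upwards [self_mem_nhdsWithin] with s' (hs : s ≤ s')
        exact div_le_div_of_nonneg_right (by linarith) hb.le
    exact tendsto_pure.1 ((tendsto_ceil_left_pure_ceil ((y - s) / b)).comp h₁)
  filter_upwards [key (m * a), key (m * a + c)] with s' h₁ h₂
  rw [window, window, h₁, h₂]

/-- Stability under limits from the right makes the complement a right neighbourhood of each of its
points. -/
theorem measurableSet_coverSet {a b c : ℝ} (hb : 0 < b) (k : ℕ) (Z : Set ℤ) :
    MeasurableSet (coverSet a b c k Z) := by
  rw [← MeasurableSet.compl_iff]
  refine MeasurableSet.of_mem_nhdsGT fun s hs => ?_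
  by_contra h
  refine hs (mem_coverSet_of_frequently (F := 𝓝[>] s) (fun m => ?_) ?_)
  · exact (eventually_window_eq hb s m).filter_mono (nhdsWithin_mono _ Set.Ioi_subset_Ici_self)
  · rw [Filter.Frequently]
    exact h

/-! ### Covers exist for every `t` or for none. -/

theorem mem_coverSet_add {a b c : ℝ} (hb : 0 < b) {k : ℕ} {t : ℝ}
    (h : t ∈ coverSet a b c k ∅) {g : ℝ} (hg : g ∈ AddSubgroup.closure {a, b}) :
    t + g ∈ coverSet a b c k ∅ := by
  obtain ⟨i, j, rfl⟩ := AddSubgroup.mem_closure_pair.1 hg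
  obtain ⟨X, -, hX⟩ := h
  have := (hX.add_left hb i).add_right hb j
  rw [add_assoc, ← zsmul_eq_mul, ← zsmul_eq_mul] at this
  exact ⟨_, Set.empty_subset _, this⟩

theorem coverSet_eq_univ_of_irrational {a b c : ℝ} (hb : 0 < b) (hab : Irrational (a / b))
    {k : ℕ} (h : (coverSet a b c k ∅).Nonempty) : coverSet a b c k ∅ = Set.univ := by
  obtain ⟨t, ht⟩ := h
  refine Set.eq_univ_of_forall fun s =>
    mem_coverSet_of_frequently (F := 𝓝[≥] s) (eventually_window_eq hb s) ?_
  have hd : Dense (AddSubgroup.closure {a, b} : Set ℝ) := dense_addSubgroupClosure_pair_iff.2 hab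
  rw [(nhdsGE_basis s).frequently_iff]
  intro u hu
  obtain ⟨g, hg, h₁, h₂⟩ := hd.exists_between (show s - t < u - t by linarith)
  exact ⟨t + g, ⟨by linarith, by linarith⟩, mem_coverSet_add hb ht hg⟩

/-- All thresholds at which a window changes lie in `dℤ`. -/
theorem window_eq_of_floor_eq {d : ℝ} (hd : 0 < d) {p q r : ℤ} (hq : 0 < q) {s s' : ℝ}
    (h : ⌊s' / d⌋ = ⌊s / d⌋) (m : ℤ) :
    window (p * d) (q * d) (r * d) s' m = window (p * d) (q * d) (r * d) s m := by
  have hb : (0 : ℝ) < q * d := mul_pos (by exact_mod_cast hq) hd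
  have key : ∀ i : ℤ, i * d ≤ s' ↔ i * d ≤ s := by
    intro i
    rw [← le_div_iff₀ hd, ← le_div_iff₀ hd, ← Int.le_floor, ← Int.le_floor, h]
  ext n
  rw [mem_window hb, mem_window hb]
  have h₁ := key (m * p - n * q)
  have h₂ := key (m * p + r - n * q)
  push_cast at h₁ h₂
  refine and_congr ⟨fun H => ?_, fun H => ?_⟩ (not_iff_not.1 ⟨fun H => ?_, fun H => ?_⟩)
  · linarith [h₁.1 (by linarith)]
  · linarith [h₁.2 (by linarith)]
  · linarith [h₂.1 (by linarith)]
  · linarith [h₂.2 (by linarith)]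

theorem coverSet_eq_univ_of_rational {d : ℝ} (hd : 0 < d) {p q r : ℤ} (hq : 0 < q)
    (hpq : IsCoprime p q) {k : ℕ} (h : (coverSet (p * d) (q * d) (r * d) k ∅).Nonempty) :
    coverSet (p * d) (q * d) (r * d) k ∅ = Set.univ := by
  have hb : (0 : ℝ) < q * d := mul_pos (by exact_mod_cast hq) hd
  obtain ⟨t, ht⟩ := h
  refine Set.eq_univ_of_forall fun s => ?_
  obtain ⟨x, y, hxy⟩ := hpq
  -- By Bézout `d` lies in this subgroup, so `t` can be moved into the same cell of length `d` as
  -- `s`.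
  have hg : ((⌊s / d⌋ - ⌊t / d⌋ : ℤ) : ℝ) * d ∈ AddSubgroup.closure {p * d, q * d} := by
    refine AddSubgroup.mem_closure_pair.2
      ⟨(⌊s / d⌋ - ⌊t / d⌋) * x, (⌊s / d⌋ - ⌊t / d⌋) * y, ?_⟩
    have hxy' : (x : ℝ) * p + y * q = 1 := by exact_mod_cast hxy
    simp only [zsmul_eq_mul]
    push_cast
    linear_combination ((⌊s / d⌋ - ⌊t / d⌋ : ℝ) * d) * hxy'
  refine mem_coverSet_of_frequently (F := pure (t + ((⌊s / d⌋ - ⌊t / d⌋ : ℤ) : ℝ) * d))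
    (fun m => ?_) ?_
  · rw [eventually_pure]
    refine window_eq_of_floor_eq hd hq ?_ m
    rw [add_div, mul_div_cancel_right₀ _ hd.ne', Int.floor_add_intCast]
    ring
  · rw [frequently_pure]
    exact mem_coverSet_add hb ht hg

theorem coverSet_eq_univ {a b c : ℝ} (hb : 0 < b)
    (hratio : Irrational (a / b) ∨
      ∃ p q : ℕ, 0 < p ∧ 0 < q ∧ Nat.Coprime p q ∧ a / b = (p : ℝ) / (q : ℝ) ∧
        ∃ n : ℤ, c / b = (n : ℝ) / (q : ℝ))
    {k : ℕ} {Z : Set ℤ} (h : (coverSet a b c k Z).Nonempty) : coverSet a b c k ∅ = Set.univ := by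
  have h' : (coverSet a b c k ∅).Nonempty := by
    obtain ⟨t, X, -, hX⟩ := h
    exact ⟨t, X, Set.empty_subset _, hX⟩
  rcases hratio with hirr | ⟨p, q, -, hq, hpq, hab, r, hcb⟩
  · exact coverSet_eq_univ_of_irrational hb hirr h'
  · have hq' : (0 : ℝ) < q := by exact_mod_cast hq
    have h₁ : a = ((p : ℤ) : ℝ) * (b / q) := by
      rw [div_eq_iff hb.ne'] at hab
      rw [hab]; push_cast; ring
    have h₂ : b = ((q : ℤ) : ℝ) * (b / q) := by
      push_cast; field_simp
    have h₃ : c = (r : ℝ) * (b / q) := by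
      rw [div_eq_iff hb.ne'] at hcb
      rw [hcb]; ring
    generalize b / q = d at h₁ h₂ h₃
    have hd : 0 < d := by
      rw [h₂] at hb
      exact pos_of_mul_pos_right hb (by exact_mod_cast hq'.le)
    subst h₁ h₂ h₃
    exact coverSet_eq_univ_of_rational hd (by exact_mod_cast hq)
      (Nat.isCoprime_iff_coprime.2 hpq) h'

/-! ### Rigidity and union of one-fold covers. -/

/-- Entering points lie in `[m a + c, (m + 1) a + c)`, whose length `a` is less than the spacing
`b`. -/
theorem window_succ_unique {a b c : ℝ} (hb : 0 < b) (hab : a < b) {t : ℝ} {m n n' : ℤ}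
    (h : n ∈ window a b c t (m + 1)) (hn : n ∉ window a b c t m)
    (h' : n' ∈ window a b c t (m + 1)) (hn' : n' ∉ window a b c t m) (ha : 0 < a) : n = n' := by
  rw [mem_window hb] at h hn h' hn'
  push_cast at h h'
  have h₁ : m * a + c ≤ t + n * b := not_lt.1 fun H => hn ⟨by linarith, H⟩
  have h₂ : m * a + c ≤ t + n' * b := not_lt.1 fun H => hn' ⟨by linarith, H⟩
  have key : ∀ i j : ℤ, m * a + c ≤ t + i * b → t + j * b < (m + 1) * a + c → j ≤ i := by
    intro i j hi hj
    by_contra! hij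
    have : ((i + 1 : ℤ) : ℝ) * b ≤ j * b :=
      mul_le_mul_of_nonneg_right (by exact_mod_cast hij) hb.le
    push_cast at this
    linarith
  exact le_antisymm (key n' n h₂ h.2) (key n n' h₁ h'.2)

theorem window_pred_unique {a b c : ℝ} (hb : 0 < b) (hab : a < b) {t : ℝ} {m n n' : ℤ}
    (h : n ∈ window a b c t m) (hn : n ∉ window a b c t (m + 1))
    (h' : n' ∈ window a b c t m) (hn' : n' ∉ window a b c t (m + 1)) (ha : 0 < a) : n = n' := by
  rw [mem_window hb] at h hn h' hn'
  push_cast at hn hn'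
  have h₁ : t + n * b < (m + 1) * a := not_le.1 fun H => hn ⟨H, by linarith⟩
  have h₂ : t + n' * b < (m + 1) * a := not_le.1 fun H => hn' ⟨H, by linarith⟩
  have key : ∀ i j : ℤ, m * a ≤ t + i * b → t + j * b < (m + 1) * a → j ≤ i := by
    intro i j hi hj
    by_contra! hij
    have : ((i + 1 : ℤ) : ℝ) * b ≤ j * b :=
      mul_le_mul_of_nonneg_right (by exact_mod_cast hij) hb.le
    push_cast at this
    linarith
  exact le_antisymm (key n' n h'.1 h₁) (key n n' h.1 h₂)

open Classical in
/-- Two sets with equally many points in `W` agree on `W` once they agree on all but one point. -/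
theorem agree_of_card_eq {W W' : Finset ℤ} {X Y : Set ℤ}
    (hcard : (W'.filter (· ∈ X)).card = (W'.filter (· ∈ Y)).card)
    (hW : ∀ n ∈ W, (n ∈ X ↔ n ∈ Y))
    (huniq : ∀ n n', n ∈ W' → n ∉ W → n' ∈ W' → n' ∉ W → n = n') :
    ∀ n ∈ W', (n ∈ X ↔ n ∈ Y) := by
  have key : ∀ X Y : Set ℤ, (W'.filter (· ∈ X)).card = (W'.filter (· ∈ Y)).card →
      (∀ n ∈ W, (n ∈ X ↔ n ∈ Y)) → ∀ n ∈ W', n ∈ X → n ∈ Y := by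
    intro X Y hcard hW n hn hX
    by_contra hY
    have hnW : n ∉ W := fun h => hY ((hW n h).1 hX)
    refine (Finset.card_lt_card (s := W'.filter (· ∈ Y)) (t := W'.filter (· ∈ X)) ?_).ne'
      hcard
    rw [Finset.ssubset_iff_of_subset]
    · exact ⟨n, Finset.mem_filter.2 ⟨hn, hX⟩, fun h => hY (Finset.mem_filter.1 h).2⟩
    · intro i hi
      obtain ⟨hi, hiY⟩ := Finset.mem_filter.1 hi
      refine Finset.mem_filter.2 ⟨hi, ?_⟩
      by_cases hiW : i ∈ W
      · exact (hW i hiW).2 hiY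
      · exact absurd (huniq n i hn hnW hi hiW ▸ hiY) hY
  exact fun n hn => ⟨key X Y hcard hW n hn, key Y X hcard.symm (fun n hn => (hW n hn).symm) n hn⟩

theorem exists_mem_window {a b c : ℝ} (ha : 0 < a) (hb : 0 < b) (hac : a ≤ c) (t : ℝ) (n : ℤ) :
    n ∈ window a b c t ⌊(t + n * b) / a⌋ := by
  rw [mem_window hb]
  have h₁ := Int.floor_le ((t + n * b) / a)
  have h₂ := Int.lt_floor_add_one ((t + n * b) / a)
  rw [le_div_iff₀ ha] at h₁
  rw [div_lt_iff₀ ha] at h₂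
  exact ⟨h₁, by linarith⟩

/-- Two one-fold covers with a common point coincide. -/
theorem IsCover.eq_of_mem {a b c : ℝ} (ha : 0 < a) (hab : a < b) (hac : a ≤ c) {t : ℝ}
    {X Y : Set ℤ} (hX : IsCover a b c 1 t X) (hY : IsCover a b c 1 t Y) {n : ℤ}
    (hnX : n ∈ X) (hnY : n ∈ Y) : X = Y := by
  classical
  have hb := ha.trans hab
  have base : ∃ m, ∀ i ∈ window a b c t m, (i ∈ X ↔ i ∈ Y) := by
    refine ⟨⌊(t + n * b) / a⌋, fun i hi => ?_⟩
    have hn := exists_mem_window ha hb hac t n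
    have h₁ := Finset.card_le_one.1 (hX ⌊(t + n * b) / a⌋).le
    have h₂ := Finset.card_le_one.1 (hY ⌊(t + n * b) / a⌋).le
    constructor
    · intro h
      rw [h₁ i (Finset.mem_filter.2 ⟨hi, h⟩) n (Finset.mem_filter.2 ⟨hn, hnX⟩)]
      exact hnY
    · intro h
      rw [h₂ i (Finset.mem_filter.2 ⟨hi, h⟩) n (Finset.mem_filter.2 ⟨hn, hnY⟩)]
      exact hnX
  obtain ⟨m₀, h₀⟩ := base
  -- Each move to a neighbouring window adds at most one index, whose membership is forced by the
  -- point count.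
  have all : ∀ m, ∀ i ∈ window a b c t m, (i ∈ X ↔ i ∈ Y) := by
    intro m
    induction m using Int.inductionOn' (b := m₀) with
    | zero => exact h₀
    | succ m _ ih =>
      exact agree_of_card_eq ((hX _).trans (hY _).symm) ih fun _ _ h₁ h₂ h₃ h₄ =>
        window_succ_unique hb hab h₁ h₂ h₃ h₄ ha
    | pred m _ ih =>
      refine agree_of_card_eq ((hX _).trans (hY _).symm) ih fun _ _ h₁ h₂ h₃ h₄ => ?_
      exact window_pred_unique hb hab (m := m - 1) (c := c) h₁ (by rwa [sub_add_cancel]) h₃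
        (by rwa [sub_add_cancel]) ha
  ext i
  exact all _ i (exists_mem_window ha hb hac t i)

/-- The union of two distinct one-fold covers is a two-fold cover. -/
theorem IsCover.union {a b c : ℝ} (ha : 0 < a) (hab : a < b) (hac : a ≤ c) {t : ℝ}
    {X Y : Set ℤ} (hX : IsCover a b c 1 t X) (hY : IsCover a b c 1 t Y) (hne : X ≠ Y) :
    IsCover a b c 2 t (X ∪ Y) := fun m => by
  classical
  have : (window a b c t m).filter (· ∈ X ∪ Y) =
      (window a b c t m).filter (· ∈ X) ∪ (window a b c t m).filter (· ∈ Y) := by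
    rw [← Finset.filter_or]
    rfl
  suffices h : ((window a b c t m).filter (· ∈ X ∪ Y)).card = 2 by convert h
  rw [this, Finset.card_union_of_disjoint, hX m, hY m]
  refine Finset.disjoint_left.2 fun n hn hn' => hne ?_
  exact hX.eq_of_mem ha hab hac hY (Finset.mem_filter.1 hn).2 (Finset.mem_filter.1 hn').2

/-! ### Splitting a two-fold cover. -/

open Classical in
/-- The signed number of points of `X` between `0` and `n`. -/
noncomputable def count (X : Set ℤ) (n : ℤ) : ℤ :=
  ((Finset.Ico 0 n).filter (· ∈ X)).card - ((Finset.Ico n 0).filter (· ∈ X)).card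

theorem count_zero (X : Set ℤ) : count X 0 = 0 := by
  simp [count]

open Classical in
theorem count_succ (X : Set ℤ) (n : ℤ) :
    count X (n + 1) = count X n + if n ∈ X then 1 else 0 := by
  rcases le_or_gt 0 n with hn | hn
  · have h₁ : Finset.Ico 0 (n + 1) = insert n (Finset.Ico 0 n) := by ext; simp; lia
    have h₂ : Finset.Ico (n + 1) 0 = ∅ := by ext; simp; lia
    have h₃ : Finset.Ico n 0 = ∅ := by ext; simp; lia
    rw [count, count, h₁, h₂, h₃, Finset.filter_insert]
    split_ifs with h
    · rw [Finset.card_insert_of_notMem (by simp)]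
      push_cast
      ring
    · simp
  · have h₁ : Finset.Ico n 0 = insert n (Finset.Ico (n + 1) 0) := by ext; simp; lia
    have h₂ : Finset.Ico 0 (n + 1) = ∅ := by ext; simp; lia
    have h₃ : Finset.Ico 0 n = ∅ := by ext; simp; lia
    rw [count, count, h₁, h₂, h₃, Finset.filter_insert]
    split_ifs with h
    · rw [Finset.card_insert_of_notMem (by simp)]
      push_cast
      ring
    · simp

theorem count_of_consecutive {X : Set ℤ} {p q : ℤ} (hp : p ∈ X) (hpq : p < q)
    (h : ∀ n, p < n → n < q → n ∉ X) : count X q = count X p + 1 := by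
  have key : ∀ i : ℕ, p + 1 + i ≤ q → count X (p + 1 + i) = count X p + 1 := by
    intro i
    induction i with
    | zero => intro _; simp [count_succ, hp]
    | succ i ih =>
      intro hi
      push_cast at hi ⊢
      rw [← add_assoc, count_succ, ih (by lia), if_neg (h _ (by lia) (by lia)), add_zero]
  have := key (q - p - 1).toNat (by lia)
  rwa [show p + 1 + ((q - p - 1).toNat : ℤ) = q by lia] at this

/-- Every second point of a two-fold cover gives a one-fold cover. -/
theorem IsCover.even_count {a b c : ℝ} {t : ℝ} {X : Set ℤ}
    (hX : IsCover a b c 2 t X) : IsCover a b c 1 t {n ∈ X | Even (count X n)} := fun m => by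
  classical
  obtain ⟨p, q, hpq, hW⟩ : ∃ p q, p < q ∧ (window a b c t m).filter (· ∈ X) = {p, q} := by
    obtain ⟨p, q, hpq, hW⟩ := Finset.card_eq_two.1 (hX m)
    rcases lt_or_gt_of_ne hpq with h | h
    · exact ⟨p, q, h, hW⟩
    · exact ⟨q, p, h, by rw [hW, Finset.pair_comm]⟩
  have hp : p ∈ (window a b c t m).filter (· ∈ X) := by simp [hW]
  have hq : q ∈ (window a b c t m).filter (· ∈ X) := by simp [hW]
  rw [Finset.mem_filter] at hp hq
  -- Windows are intervals, so their two points are consecutive in `X` and their counts have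
  -- opposite parity.
  have hc : count X q = count X p + 1 := by
    refine count_of_consecutive hp.2 hpq fun n h₁ h₂ hn => ?_
    have : n ∈ (window a b c t m).filter (· ∈ X) := by
      refine Finset.mem_filter.2 ⟨?_, hn⟩
      have hp := Finset.mem_Ico.1 hp.1
      have hq := Finset.mem_Ico.1 hq.1
      exact Finset.mem_Ico.2 ⟨hp.1.trans h₁.le, h₂.trans hq.2⟩
    rw [hW] at this
    simp only [Finset.mem_insert, Finset.mem_singleton] at this
    lia
  have : (window a b c t m).filter (· ∈ {n ∈ X | Even (count X n)}) =
      ({p, q} : Finset ℤ).filter fun n => Even (count X n) := by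
    rw [← hW, Finset.filter_filter]
    rfl
  suffices h : ((window a b c t m).filter (· ∈ {n ∈ X | Even (count X n)})).card = 1 by
    convert h
  rw [this]
  by_cases he : Even (count X p)
  · have ho : ¬ Even (count X q) := by rw [hc]; simpa [Int.even_add_one] using he
    rw [Finset.filter_insert, if_pos he, Finset.filter_singleton, if_neg ho]
    simp
  · have ho : Even (count X q) := by rw [hc]; simpa [Int.even_add_one] using he
    rw [Finset.filter_insert, if_neg he, Finset.filter_singleton, if_pos ho]
    simp

theorem coverSet_two_subset {a b c : ℝ} :
    coverSet a b c 2 {0} ⊆ coverSet a b c 1 {0} := by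
  rintro t ⟨X, h0, hX⟩
  refine ⟨_, ?_, hX.even_count⟩
  rintro _ rfl
  exact ⟨h0 rfl, by simp [count_zero]⟩

/-! ### Bounds for the multiplicity. -/

/-- The points of `setS` whose `j`-th translate by `b` lies before the next point of the cover. -/
def level (a b c : ℝ) (j : ℕ) : Set ℝ :=
  {t | t ∈ coverSet a b c 1 {0} ∧ t + j * b < ⌊t / a⌋ * a + c}

/-- The number of indices `j ≤ N` with `s - j b` in the `j`-th level. -/
noncomputable def multiplicity (a b c : ℝ) (N : ℕ) (s : ℝ) : ℝ :=
  ∑ j ∈ Finset.range (N + 1), (level a b c j).indicator 1 (s - j * b)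

open Classical in
theorem multiplicity_eq_card (a b c : ℝ) (N : ℕ) (s : ℝ) :
    multiplicity a b c N s =
      ((Finset.range (N + 1)).filter fun j => s - j * b ∈ level a b c j).card := by
  rw [multiplicity, Finset.card_filter, Nat.cast_sum]
  refine Finset.sum_congr rfl fun j _ => ?_
  by_cases h : s - j * b ∈ level a b c j <;> simp [h]

theorem le_multiplicity {a b c : ℝ} (ha : 0 < a) (hab : a < b) {k : ℕ}
    (huniv : coverSet a b c k ∅ = Set.univ)
    (hsub : coverSet a b c k {0} ⊆ coverSet a b c 1 {0}) (s : ℝ) :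
    (k : ℝ) ≤ multiplicity a b c ⌊c / b⌋.toNat s := by
  classical
  have hb := ha.trans hab
  obtain ⟨X, -, hX⟩ : s ∈ coverSet a b c k ∅ := huniv ▸ Set.mem_univ s
  -- The first window whose right end exceeds `s`; it exceeds `s` by at most `a < b`, so only
  -- indices `p ≤ 0` occur, and each `p ∈ X` among them contributes `j = -p`.
  set m : ℤ := ⌊(s - c) / a⌋ + 1 with hm
  have hm₁ : s < m * a + c := by
    have := Int.lt_floor_add_one ((s - c) / a)
    rw [div_lt_iff₀ ha] at this
    rw [hm]; push_cast; linarith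
  have hm₂ : m * a + c ≤ s + a := by
    have := Int.floor_le ((s - c) / a)
    rw [le_div_iff₀ ha] at this
    rw [hm]; push_cast; linarith
  have hneg : ∀ p ∈ window a b c s m, p ≤ 0 := by
    intro p hp
    rw [mem_window hb] at hp
    by_contra! h
    have : (1 : ℝ) * b ≤ p * b := mul_le_mul_of_nonneg_right (by exact_mod_cast h) hb.le
    linarith
  rw [multiplicity_eq_card, ← hX m, Nat.cast_le]
  refine Finset.card_le_card_of_injOn (fun p => (-p).toNat) (fun p hp => ?_) fun p hp q hq h => ?_
  · obtain ⟨hpW, hpX⟩ := Finset.mem_filter.1 hp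
    have hp0 := hneg p hpW
    rw [mem_window hb] at hpW
    have hcast : (((-p).toNat : ℕ) : ℝ) = -p := by
      have : (((-p).toNat : ℤ) : ℝ) = ((-p : ℤ) : ℝ) := by rw [Int.toNat_of_nonneg (by lia)]
      push_cast at this
      exact this
    have hle : -p ≤ ⌊c / b⌋ := by
      rw [Int.le_floor, le_div_iff₀ hb]
      push_cast
      linarith
    refine Finset.mem_coe.2 (Finset.mem_filter.2 ⟨Finset.mem_range.2 (by lia), ?_⟩)
    have hs : s - ((-p).toNat : ℕ) * b = s + p * b := by rw [hcast]; ring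
    refine ⟨?_, ?_⟩
    · rw [hs]
      exact hsub (hX.mem_coverSet hb hpX)
    · rw [sub_add_cancel, hs]
      have : m ≤ ⌊(s + p * b) / a⌋ := by
        rw [Int.le_floor, le_div_iff₀ ha]
        exact hpW.1
      have : (m : ℝ) * a ≤ ⌊(s + p * b) / a⌋ * a :=
        mul_le_mul_of_nonneg_right (by exact_mod_cast this) ha.le
      linarith
  · have hp := hneg p (Finset.mem_filter.1 hp).1
    have hq := hneg q (Finset.mem_filter.1 hq).1
    simp only at h
    lia

/-- The one-fold covers through `0` and through `i` differ, since both indices lie in one window;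
their union is two-fold. -/
theorem mem_coverSet_two {a b c : ℝ} (ha : 0 < a) (hab : a < b) (hac : a ≤ c) {t : ℝ}
    (ht : t ∈ coverSet a b c 1 {0}) {i : ℕ} (hi : 0 < i)
    (hti : t + i * b ∈ coverSet a b c 1 {0}) (hlt : t + i * b < ⌊t / a⌋ * a + c) :
    t ∈ coverSet a b c 2 {0} := by
  classical
  have hb := ha.trans hab
  obtain ⟨X, h0, hX⟩ := ht
  obtain ⟨Y, h0', hY⟩ := hti
  have hY' := hY.add_right hb (-i)
  rw [show t + i * b + ((-i : ℤ) : ℝ) * b = t by push_cast; ring] at hY'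
  refine ⟨_, h0.trans Set.subset_union_left, hX.union ha hab hac hY' fun h => ?_⟩
  have hiX : (i : ℤ) ∈ X := by
    rw [h]
    simpa using h0' rfl
  have hW := exists_mem_window ha hb hac t 0
  simp only [Int.cast_zero, zero_mul, add_zero] at hW
  have hW' : (i : ℤ) ∈ window a b c t ⌊t / a⌋ := by
    rw [mem_window hb] at hW ⊢
    simp only [Int.cast_zero, zero_mul, add_zero, Int.cast_natCast] at hW ⊢
    exact ⟨hW.1.trans (le_add_of_nonneg_right (by positivity)), hlt⟩
  have := Finset.card_le_one.1 (hX ⌊t / a⌋).le i (Finset.mem_filter.2 ⟨hW', hiX⟩) 0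
    (Finset.mem_filter.2 ⟨hW, h0 rfl⟩)
  lia

theorem multiplicity_le_one {a b c : ℝ} (ha : 0 < a) (hab : a < b) (hac : a ≤ c)
    (hD : coverSet a b c 2 {0} = ∅) (N : ℕ) (s : ℝ) : multiplicity a b c N s ≤ 1 := by
  classical
  have key : ∀ j j' : ℕ, j < j' → s - j * b ∈ level a b c j →
      s - j' * b ∉ level a b c j' := by
    intro j j' hjj h h'
    obtain ⟨i, rfl⟩ := Nat.exists_eq_add_of_lt hjj
    have hs : s - ((j + i + 1 : ℕ) : ℝ) * b + ((i + 1 : ℕ) : ℝ) * b = s - j * b := by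
      push_cast; ring
    refine Set.notMem_empty _ (hD ▸ mem_coverSet_two ha hab hac h'.1 (Nat.succ_pos i) ?_ ?_)
    · rw [hs]
      exact h.1
    · have := h'.2
      rw [hs]
      rw [sub_add_cancel] at this
      have : 0 ≤ (j : ℝ) * b := mul_nonneg j.cast_nonneg (ha.trans hab).le
      linarith
  rw [multiplicity_eq_card]
  norm_cast
  refine Finset.card_le_one.2 fun j hj j' hj' => ?_
  rw [Finset.mem_filter] at hj hj'
  rcases lt_trichotomy j j' with h | h | h
  · exact absurd hj'.2 (key j j' h hj.2)
  · exact h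
  · exact absurd hj.2 (key j' j h hj'.2)

/-! ### The integral of the multiplicity over a period. -/

theorem measurableSet_level {a b c : ℝ} (hb : 0 < b) (j : ℕ) :
    MeasurableSet (level a b c j) := by
  have : Measurable fun t : ℝ => (⌊t / a⌋ : ℝ) :=
    measurable_from_top.comp (Int.measurable_floor.comp (measurable_id.div_const a))
  exact (measurableSet_coverSet hb 1 {0}).inter
    (measurableSet_lt (measurable_id.add_const _) ((this.mul_const a).add_const c))

theorem level_periodic {a b c : ℝ} (ha : 0 < a) (hb : 0 < b) (j : ℕ) :
    Function.Periodic ((level a b c j).indicator (1 : ℝ → ℝ)) a := by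
  intro t
  have : t + a ∈ level a b c j ↔ t ∈ level a b c j := by
    refine and_congr ?_ ?_
    · simpa using coverSet_add_left hb (a := a) (c := c) (k := 1) (Z := {0}) (t := t) 1
    · rw [add_div, div_self ha.ne', Int.floor_add_one]
      push_cast
      constructor <;> intro h <;> linarith
  by_cases h : t ∈ level a b c j
  · rw [Set.indicator_of_mem h, Set.indicator_of_mem (this.2 h)]
    rfl
  · rw [Set.indicator_of_notMem h, Set.indicator_of_notMem (mt this.1 h)]

theorem integrable_indicator_level {a b c : ℝ} (hb : 0 < b) (j : ℕ) (x y : ℝ) :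
    IntervalIntegrable ((level a b c j).indicator (1 : ℝ → ℝ)) volume x y := by
  refine (intervalIntegrable_const (c := (1 : ℝ))).mono_fun
    ((measurable_one.indicator (measurableSet_level hb j)).aestronglyMeasurable)
    (Filter.Eventually.of_forall fun t => ?_)
  simpa using norm_indicator_le_norm_self (1 : ℝ → ℝ) t

theorem integrable_indicator_level_sub {a b c : ℝ} (hb : 0 < b) (j : ℕ) (x y : ℝ) :
    IntervalIntegrable (fun s => (level a b c j).indicator (1 : ℝ → ℝ) (s - j * b))
      volume x y := by
  have := (integrable_indicator_level (a := a) (c := c) hb j (x - j * b)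
    (y - j * b)).comp_sub_right (j * b)
  simpa using this

theorem integrable_multiplicity {a b c : ℝ} (hb : 0 < b) (N : ℕ) (x y : ℝ) :
    IntervalIntegrable (multiplicity a b c N) volume x y := by
  have h : multiplicity a b c N = ∑ j ∈ Finset.range (N + 1),
      fun s => (level a b c j).indicator (1 : ℝ → ℝ) (s - j * b) := by
    funext s
    simp [multiplicity]
  rw [h]
  exact IntervalIntegrable.sum _ fun j _ => integrable_indicator_level_sub hb j x y

theorem integral_multiplicity {a b c : ℝ} (ha : 0 < a) (hb : 0 < b) (N : ℕ) :
    ∫ s in 0..a, multiplicity a b c N s =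
      ∑ j ∈ Finset.range (N + 1), volume.real (level a b c j ∩ Set.Ico 0 a) := by
  simp only [multiplicity]
  rw [intervalIntegral.integral_finsetSum fun j _ => integrable_indicator_level_sub hb j 0 a]
  refine Finset.sum_congr rfl fun j _ => ?_
  -- Periodicity of the level absorbs the shift by `j b`.
  rw [intervalIntegral.integral_comp_sub_right, sub_eq_add_neg a, add_comm a, zero_sub,
    (level_periodic ha hb j).intervalIntegral_add_eq (-(j * b)) 0, zero_add,
    intervalIntegral.integral_of_le ha.le, ← integral_Ico_eq_integral_Ioc,
    integral_indicator_one (measurableSet_level hb j),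
    measureReal_restrict_apply (measurableSet_level hb j)]

/-- No cover point lies in the hole `[c₀ + a - b, c₀)`. -/
theorem notMem_coverSet_of_mem_hole {a b c : ℝ} (ha : 0 < a) (hab : a < b)
    (hc₀ : b - a < cZero b c) (hc₀' : cZero b c < a) (hac : a ≤ c) {t : ℝ}
    (h₁ : cZero b c + a - b ≤ t) (h₂ : t < cZero b c) : t ∉ coverSet a b c 1 {0} := by
  classical
  have hb := ha.trans hab
  rintro ⟨X, h0, hX⟩
  have hW : (0 : ℤ) ∈ window a b c t 0 := by
    rw [mem_window hb]
    push_cast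
    exact ⟨by linarith, by linarith⟩
  obtain ⟨n, hn⟩ := Finset.card_pos.1 (show 0 < _ by rw [hX 1]; exact one_pos)
  obtain ⟨hn, hnX⟩ := Finset.mem_filter.1 hn
  rw [mem_window hb] at hn
  push_cast at hn
  -- Since `t < a`, the window at `a` has lost the index `0` and needs a new point in `[c, c + a)`;
  -- the bounds on `t` leave no multiple of `b` that reaches it.
  have hge : c ≤ t + n * b := by
    by_contra! h
    have hn' : n ∈ window a b c t 0 := by
      rw [mem_window hb]
      push_cast
      exact ⟨by linarith, by linarith⟩
    have := Finset.card_le_one.1 (hX 0).le n (Finset.mem_filter.2 ⟨hn', hnX⟩) 0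
      (Finset.mem_filter.2 ⟨hW, h0 rfl⟩)
    rw [this] at hn
    push_cast at hn
    linarith
  have hc : c = cZero b c + ⌊c / b⌋ * b := by rw [cZero]; ring
  have hlt : ⌊c / b⌋ < n := by
    by_contra! h
    have : (n : ℝ) * b ≤ ⌊c / b⌋ * b := mul_le_mul_of_nonneg_right (by exact_mod_cast h) hb.le
    linarith
  have : ((⌊c / b⌋ + 1 : ℤ) : ℝ) * b ≤ n * b :=
    mul_le_mul_of_nonneg_right (by exact_mod_cast hlt) hb.le
  push_cast at this
  linarith

theorem level_inter_of_lt {a b c : ℝ} (ha : 0 < a) (hab : a < b)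
    (hc₀ : b - a < cZero b c) (hc₀' : cZero b c < a) (hac : a ≤ c) {j : ℕ}
    (hj : (j : ℤ) < ⌊c / b⌋) :
    level a b c j ∩ Set.Ico 0 a =
      coverSet a b c 1 {0} ∩ Set.Ico 0 (cZero b c + a - b) ∪
        coverSet a b c 1 {0} ∩ Set.Ico (cZero b c) a := by
  have hb := ha.trans hab
  have hc : c = cZero b c + ⌊c / b⌋ * b := by rw [cZero]; ring
  have hj' : ((j + 1 : ℤ) : ℝ) * b ≤ ⌊c / b⌋ * b :=
    mul_le_mul_of_nonneg_right (by exact_mod_cast hj) hb.le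
  push_cast at hj'
  ext t
  constructor
  · rintro ⟨⟨ht, -⟩, h0, hta⟩
    rcases lt_or_ge t (cZero b c + a - b) with h | h
    · exact Or.inl ⟨ht, h0, h⟩
    · rcases lt_or_ge t (cZero b c) with h' | h'
      · exact absurd ht (notMem_coverSet_of_mem_hole ha hab hc₀ hc₀' hac h h')
      · exact Or.inr ⟨ht, h', hta⟩
  · intro h
    have ⟨ht, h0, hta⟩ : t ∈ coverSet a b c 1 {0} ∧ 0 ≤ t ∧ t < a := by
      rcases h with ⟨ht, h₁, h₂⟩ | ⟨ht, h₁, h₂⟩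
      · exact ⟨ht, h₁, by linarith⟩
      · exact ⟨ht, by linarith, h₂⟩
    refine ⟨⟨ht, ?_⟩, h0, hta⟩
    rw [Int.floor_eq_zero_iff.2 ⟨by positivity, (div_lt_one ha).2 hta⟩]
    push_cast
    linarith

/-- On `[0, a)` the top level requires `t < c₀`, and the hole lowers this to `t < c₀ + a - b`; hence
the coefficients `⌊c/b⌋ + 1` and `⌊c/b⌋`. -/
theorem level_inter_of_eq {a b c : ℝ} (ha : 0 < a) (hab : a < b)
    (hc₀ : b - a < cZero b c) (hc₀' : cZero b c < a) (hac : a ≤ c) {j : ℕ}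
    (hj : (j : ℤ) = ⌊c / b⌋) :
    level a b c j ∩ Set.Ico 0 a =
      coverSet a b c 1 {0} ∩ Set.Ico 0 (cZero b c + a - b) := by
  have hc : c = cZero b c + j * b := by rw [cZero, ← hj]; push_cast; ring
  ext t
  constructor
  · rintro ⟨⟨ht, hlt⟩, h0, hta⟩
    rw [Int.floor_eq_zero_iff.2 ⟨by positivity, (div_lt_one ha).2 hta⟩] at hlt
    push_cast at hlt
    refine ⟨ht, h0, ?_⟩
    by_contra! h
    exact notMem_coverSet_of_mem_hole ha hab hc₀ hc₀' hac h (by linarith) ht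
  · rintro ⟨ht, h0, h⟩
    have hta : t < a := by linarith
    refine ⟨⟨ht, ?_⟩, h0, hta⟩
    rw [Int.floor_eq_zero_iff.2 ⟨by positivity, (div_lt_one ha).2 hta⟩]
    push_cast
    linarith

theorem integral_multiplicity_eq {a b c : ℝ} (ha : 0 < a) (hab : a < b)
    (hc₀ : b - a < cZero b c) (hc₀' : cZero b c < a) (hac : a ≤ c) (hfloor : 0 ≤ ⌊c / b⌋) :
    ∫ s in 0..a, multiplicity a b c ⌊c / b⌋.toNat s =
      ((⌊c / b⌋ : ℝ) + 1) *
          (volume (coverSet a b c 1 {0} ∩ Set.Ico 0 (cZero b c + a - b))).toReal +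
        (⌊c / b⌋ : ℝ) * (volume (coverSet a b c 1 {0} ∩ Set.Ico (cZero b c) a)).toReal := by
  have hb := ha.trans hab
  have hN : ((⌊c / b⌋.toNat : ℕ) : ℤ) = ⌊c / b⌋ := Int.toNat_of_nonneg hfloor
  have hN' : ((⌊c / b⌋.toNat : ℕ) : ℝ) = ⌊c / b⌋ := by exact_mod_cast congrArg (Int.cast : ℤ → ℝ) hN
  have hvol : ∀ j ∈ Finset.range ⌊c / b⌋.toNat, volume.real (level a b c j ∩ Set.Ico 0 a) =
      volume.real (coverSet a b c 1 {0} ∩ Set.Ico 0 (cZero b c + a - b)) +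
        volume.real (coverSet a b c 1 {0} ∩ Set.Ico (cZero b c) a) := by
    intro j hj
    have hj : (j : ℤ) < ⌊c / b⌋ := by
      have := Finset.mem_range.1 hj
      lia
    rw [level_inter_of_lt ha hab hc₀ hc₀' hac hj]
    refine measureReal_union ?_ ((measurableSet_coverSet hb 1 {0}).inter measurableSet_Ico) ?_ ?_
    · refine Set.disjoint_left.2 fun t h h' => ?_
      linarith [h.2.2, h'.2.1]
    · exact ((measure_mono Set.inter_subset_right).trans_lt measure_Ico_lt_top).ne
    · exact ((measure_mono Set.inter_subset_right).trans_lt measure_Ico_lt_top).ne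
  rw [integral_multiplicity ha hb, Finset.sum_range_succ, Finset.sum_congr rfl hvol,
    level_inter_of_eq ha hab hc₀ hc₀' hac hN, Finset.sum_const, Finset.card_range, nsmul_eq_mul,
    hN']
  simp only [Measure.real]
  ring

end ABCProblem

theorem mainTheorem10 (a b c : ℝ) (ha : 0 < a) (hab : a < b) (hbc : b < c)
    (hfloor : 2 ≤ ⌊c / b⌋)
    (hc₀ : b - a < ABCProblem.cZero b c) (hc₀' : ABCProblem.cZero b c < a)
    (hc₁ : 0 < ABCProblem.cOne a b c) (hc₁' : ABCProblem.cOne a b c < 2 * a - b)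
    (hS : (ABCProblem.setS a b c).Nonempty)
    (hratio : Irrational (a / b) ∨
      ∃ p q : ℕ, 0 < p ∧ 0 < q ∧ Nat.Coprime p q ∧ a / b = (p : ℝ) / (q : ℝ) ∧
        ∃ n : ℤ, c / b = (n : ℝ) / (q : ℝ)) :
    ABCProblem.setD a b c = ∅ ↔
      ((⌊c / b⌋ : ℝ) + 1) *
          (volume (ABCProblem.setS a b c ∩
            Set.Ico 0 (ABCProblem.cZero b c + a - b))).toReal +
        (⌊c / b⌋ : ℝ) *
          (volume (ABCProblem.setS a b c ∩
            Set.Ico (ABCProblem.cZero b c) a)).toReal = a := by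
  have hb := ha.trans hab
  have hac : a ≤ c := (hab.trans hbc).le
  rw [ABCProblem.setS_eq hb] at hS ⊢
  rw [ABCProblem.setD_eq hb,
    ← ABCProblem.integral_multiplicity_eq ha hab hc₀ hc₀' hac (by lia)]
  have hone := ABCProblem.le_multiplicity ha hab (ABCProblem.coverSet_eq_univ hb hratio hS) subset_rfl
  constructor
  · intro hD
    have : ABCProblem.multiplicity a b c ⌊c / b⌋.toNat = fun _ => 1 := by
      funext s
      refine le_antisymm (ABCProblem.multiplicity_le_one ha hab hac hD _ s) ?_
      simpa using hone s
    simp [this]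
  · intro hint
    by_contra hD
    have htwo := ABCProblem.le_multiplicity ha hab
      (ABCProblem.coverSet_eq_univ hb hratio (Set.nonempty_iff_ne_empty.2 hD))
      ABCProblem.coverSet_two_subset
    have := intervalIntegral.integral_mono_on ha.le intervalIntegrable_const
      (ABCProblem.integrable_multiplicity hb _ 0 a) fun s _ => htwo s
    rw [hint, intervalIntegral.integral_const, smul_eq_mul] at this
    push_cast at this
    linarith
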